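/- Let $K, I, J$ be finite sets and consider a stochastic game with state space $K$, action sets $I$ and $J$, and transition function $q:K\times I\times J\to\Delta(K)$. For stationary strategies $x:K\to\Delta(I)$ and $y:K\to\Delta(J)$ let $Q(x,y)\in\mathbb R^{K\times K}$ be the induced stochastic matrix, $Q(x,y)^{\ell,\ell'}=\sum_{i,j}x^\ell(i)\,y^\ell(j)\,q(\ell'\mid \ell,i,j)$. Let $(x_\lambda,y_\lambda)_{\lambda\in[0,1]}$ be a family of pairs of stationary strategies (for instance optimal ones in the $\lambda$-discounted games, extended by their limit at $\lambda=0$) such that $Q_\lambda:=Q(x_\lambda,y_\lambda)$ is critical: $Q_0=\mathrm{Id}$ and $$Q_\lambda=\mathrm{Id}+A\lambda+o(\lambda)\qquad(\lambda\to0^+)$$ for a matrix $A\in\mathbb R^{K\times K}$ with nonnegative off-diagonal entries and zero row sums. For a sequence $\theta=(\theta_m)_{m\ge1}$ of nonnegative weights with $\sum_{m\ge1}\theta_m=1$, put $\|\theta\|=\max_m\theta_m$, let $\lambda^\theta_m=\theta_m/\sum_{m'\ge m}\theta_{m'}$ (with $0/0=0$), let $Q^\theta_m=Q_{\lambda^\theta_m}$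 be the transition matrix at stage $m$ when the players use $x_{\lambda^\theta_m}$ and $y_{\lambda^\theta_m}$, and let $\varphi(\theta,t)=\inf\{M\ge1:\sum_{m=1}^M\theta_m\ge t\}\in\mathbb N\cup\{+\infty\}$, with $\inf\emptyset=+\infty$. Then for every $t\in[0,1]$ the limit $$\Pi_t:=\lim_{\|\theta\|\to0}\ \sum_{1\le m\le\varphi(\theta,t)}\theta_m\,Q^\theta_1Q^\theta_2\cdots Q^\theta_m$$ exists (the sums being absolutely convergent) and $$\Pi_t=\int_0^t e^{-\ln(1-s)A}\,ds,$$ where the integrand is integrable on $(0,t)$. -/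

import Mathlib

open Filter Topology

noncomputable section

/-- A (finite) stochastic game: `K` states, `I`, `J` the action sets, `g` the stage payoff and
`q k i j` the law of the next state. -/
structure StochasticGame (K I J : Type*) [Fintype K] where
  g : K → I → J → ℝ
  q : K → I → J → stdSimplex ℝ K

/-- A stationary strategy with actions in `I`: a mixed action for every state. -/
abbrev StationaryStrategy (K I : Type*) [Fintype I] := K → stdSimplex ℝ I

/-- The stochastic matrix on the state space induced by mixed actions `x k`, `y k` played in
each state `k`. -/
def StochasticGame.transitionMatrix {K I J : Type*} [Fintype K] [Fintype I] [Fintype J]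
    (G : StochasticGame K I J) (x : StationaryStrategy K I) (y : StationaryStrategy K J) :
    Matrix K K ℝ :=
  Matrix.of fun k l => ∑ i, ∑ j, (x k).1 i * (y k).1 j * (G.q k i j).1 l

/-- A normalized sequence of nonnegative weights `(θ_m)_{m ≥ 1}`; stages are numbered from `1`, and
the unused index `0` gets the weight `0`. -/
structure Evaluation where
  weight : ℕ → ℝ
  weight_zero : weight 0 = 0
  weight_nonneg : ∀ m, 0 ≤ weight m
  hasSum_weight : HasSum weight 1

namespace Evaluation

/-- `‖θ‖ = max_m θ_m`. -/
def maxWeight (θ : Evaluation) : ℝ := ⨆ m, θ.weight m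

/-- The filter `‖θ‖ → 0` on evaluations. -/
def vanishing : Filter Evaluation := comap maxWeight (𝓝 0)

/-- `λ_m = θ_m / ∑_{m' ≥ m} θ_{m'}`. (It is `0` when the tail is `0`; that only
happens after all the weight has been used.) -/
def discount (θ : Evaluation) (m : ℕ) : ℝ := θ.weight m / ∑' r, θ.weight (m + r)

/-- The clock function `φ(θ, t) = inf {M ≥ 1 | ∑_{m=1}^M θ_m ≥ t}`, which is `⊤` when
there is no such `M` (possible for `t = 1` only). -/
def clock (θ : Evaluation) (t : ℝ) : ℕ∞ :=
  ⨅ (M : ℕ) (_ : 1 ≤ M ∧ t ≤ ∑ m ∈ Finset.Icc 1 M, θ.weight m), (M : ℕ∞)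

/-- The Markov strategy which plays `x_{λ_m}` at stage `m`. -/
def strategy {K I : Type*} [Fintype I] (θ : Evaluation) (x : ℝ → StationaryStrategy K I) (m : ℕ) :
    StationaryStrategy K I := x (θ.discount m)

end Evaluation

/-- `A` is the transition (rate) matrix of a continuous-time Markov chain. -/
def IsRateMatrix {K : Type*} [Fintype K] (A : Matrix K K ℝ) : Prop :=
  (∀ k l, k ≠ l → 0 ≤ A k l) ∧ ∀ k, ∑ l, A k l = 0

/-- The family `(Q_r)` is critical with rate matrix `A`: `Q_r = Id + A r + o(r)` as `r → 0`, `r > 0`.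
At `r = 0`, which occurs as `λ_m` at the stages of weight zero, the family takes its limit value
`Id`. -/
def IsCriticalWith {K : Type*} [Fintype K] [DecidableEq K] (Q : ℝ → Matrix K K ℝ)
    (A : Matrix K K ℝ) : Prop :=
  IsRateMatrix A ∧ Q 0 = 1 ∧
    ∀ k l, (fun r : ℝ => (Q r - (1 + r • A)) k l) =o[𝓝[>] 0] (fun r : ℝ => r)

namespace StochasticGame

variable {K I J : Type*} [Fintype K] [Fintype I] [Fintype J]

/-- `Q^θ_m`: the transition matrix at stage `m` when the players use `x_{λ_m}`, `y_{λ_m}`. -/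
def stageMatrix (G : StochasticGame K I J) (x : ℝ → StationaryStrategy K I)
    (y : ℝ → StationaryStrategy K J) (θ : Evaluation) (m : ℕ) : Matrix K K ℝ :=
  G.transitionMatrix (θ.strategy x m) (θ.strategy y m)

/-- The term `θ_m Q^θ_1 ⋯ Q^θ_m` if `1 ≤ m ≤ φ(θ, t)`, and `0` for the other `m`. -/
def cumulatedTerm [DecidableEq K] (G : StochasticGame K I J) (x : ℝ → StationaryStrategy K I)
    (y : ℝ → StationaryStrategy K J) (θ : Evaluation) (t : ℝ) : ℕ → Matrix K K ℝ :=
  Set.indicator {m : ℕ | 1 ≤ m ∧ (m : ℕ∞) ≤ θ.clock t} fun m =>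
    θ.weight m • ((List.range m).map fun r => G.stageMatrix x y θ (r + 1)).prod

end StochasticGame

end

/-! Write P(s) = e^{-ln(1-s)A}, and let s_m be the weight spent up to stage m. Since λ_{m+1} =
θ_{m+1}/(1-s_m), one has (1-s_m)(1-λ_{m+1}) = 1-s_{m+1}, so P(s_m)P(λ_{m+1}) = P(s_{m+1}) exactly as
long as s_{m+1} < 1 (`fractionFlow_mul`). Criticality says Q_λ = P(λ) + o(λ), so Q_1⋯Q_m should be
close to P(s_m), and the weighted sum is then nearly a Riemann sum of P.

In the maximal row-sum norm all Q_λ and P(s) have norm at most 1, so one-stage errors add up without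
amplification. While s_m ≤ 1-δ, stage m costs at most ηλ_m ≤ (η/δ)θ_m; the remaining stages carry
weight about δ and are bounded trivially. This gives an estimate uniform in the number of stages
(`exists_norm_weightedSum_sub_integral_le`), hence valid at the clock time, whether finite or not.
-/

/-! ### The contraction semigroup in the time scale of the game. -/

section ContractionSemigroup

variable {𝔸 : Type*} [NormedRing 𝔸] [NormedAlgebra ℝ 𝔸]

/-- `a` generates a semigroup `τ ↦ e^{τa}` of contractions. -/
def GeneratesContractions (a : 𝔸) : Prop :=
  ∀ τ : ℝ, 0 ≤ τ → ‖NormedSpace.exp (τ • a)‖ ≤ 1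

/-- `e^{-ln(1-s)a}`: the semigroup generated by `a` at the time which corresponds to the fraction
`s` of the game. -/
noncomputable def fractionFlow (a : 𝔸) (s : ℝ) : 𝔸 :=
  NormedSpace.exp ((-Real.log (1 - s)) • a)

/-- The endpoint s = 1 is included because `Real.log 0 = 0` makes the flow equal to 1 there. -/
theorem GeneratesContractions.norm_fractionFlow_le_one {a : 𝔸} (ha : GeneratesContractions a)
    {s : ℝ} (hs : s ∈ Set.Icc (0 : ℝ) 1) : ‖fractionFlow a s‖ ≤ 1 :=
  ha _ (neg_nonneg.2 (Real.log_nonpos (sub_nonneg.2 hs.2) (sub_le_self 1 hs.1)))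

theorem fractionFlow_zero (a : 𝔸) : fractionFlow a 0 = 1 := by
  simp [fractionFlow]

theorem GeneratesContractions.norm_integral_fractionFlow_le {a : 𝔸} (ha : GeneratesContractions a) {u v : ℝ}
    (hu : u ∈ Set.Icc (0 : ℝ) 1) (hv : v ∈ Set.Icc (0 : ℝ) 1) :
    ‖∫ s in u..v, fractionFlow a s‖ ≤ |v - u| := by
  rw [← one_mul |v - u|]
  exact intervalIntegral.norm_integral_le_of_norm_le_const fun s hs =>
    ha.norm_fractionFlow_le_one (Set.uIcc_subset_Icc hu hv (Set.uIoc_subset_uIcc hs))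

variable [CompleteSpace 𝔸]

theorem norm_exp_le_exp_norm [NormOneClass 𝔸] (b : 𝔸) :
    ‖NormedSpace.exp b‖ ≤ Real.exp ‖b‖ := by
  have hr : HasSum (fun n : ℕ => ((n.factorial : ℝ)⁻¹) • ‖b‖ ^ n) (Real.exp ‖b‖) := by
    rw [Real.exp_eq_exp_ℝ]
    exact NormedSpace.exp_series_hasSum_exp' (𝕂 := ℝ) ‖b‖
  rw [← (NormedSpace.exp_series_hasSum_exp' (𝕂 := ℝ) b).tsum_eq]
  refine tsum_of_norm_bounded hr fun n => ?_
  rw [norm_smul, Real.norm_of_nonneg (by positivity), smul_eq_mul]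
  gcongr
  exact norm_pow_le b n

theorem generatesContractions_sub_algebraMap [NormOneClass 𝔸] {b : 𝔸} {c : ℝ} (hb : ‖b‖ ≤ c) :
    GeneratesContractions (b - algebraMap ℝ 𝔸 c) := by
  let +nondep : NormedAlgebra ℚ 𝔸 := .restrictScalars ℚ ℝ 𝔸
  intro τ hτ
  have hsplit : τ • (b - algebraMap ℝ 𝔸 c) = τ • b + algebraMap ℝ 𝔸 (-(τ * c)) := by
    rw [smul_sub, map_neg, map_mul, Algebra.smul_def τ (algebraMap ℝ 𝔸 c), sub_eq_add_neg]
  rw [hsplit, NormedSpace.exp_add_of_commute (Algebra.commutes _ _).symm,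
    ← NormedSpace.algebraMap_exp_comm]
  refine (norm_mul_le _ _).trans ?_
  rw [norm_algebraMap', ← Real.exp_eq_exp_ℝ, Real.norm_of_nonneg (Real.exp_pos _).le]
  calc _ ≤ Real.exp (τ * c) * Real.exp (-(τ * c)) := by
        refine mul_le_mul_of_nonneg_right ((norm_exp_le_exp_norm _).trans ?_) (Real.exp_pos _).le
        rw [norm_smul, Real.norm_of_nonneg hτ]
        gcongr
    _ = 1 := by rw [← Real.exp_add, add_neg_cancel, Real.exp_zero]

/-- The hypothesis on r means (1-s)(1-r) = 1-s', which the logarithm turns into addition of times.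
-/
theorem fractionFlow_mul (a : 𝔸) {s s' r : ℝ} (hs : s < 1) (hs' : s' < 1)
    (h : r * (1 - s) = s' - s) : fractionFlow a s * fractionFlow a r = fractionFlow a s' := by
  let +nondep : NormedAlgebra ℚ 𝔸 := .restrictScalars ℚ ℝ 𝔸
  have hr : 1 - r = (1 - s') / (1 - s) := by
    rw [eq_div_iff (sub_pos.2 hs).ne']; linarith
  rw [fractionFlow, fractionFlow, fractionFlow, ← NormedSpace.exp_add_of_commute
    (((Commute.refl a).smul_left _).smul_right _), ← add_smul, hr,
    Real.log_div (sub_pos.2 hs').ne' (sub_pos.2 hs).ne']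
  congr 2
  ring

theorem hasDerivAt_fractionFlow_zero (a : 𝔸) : HasDerivAt (fractionFlow a) a 0 := by
  have h1 : HasDerivAt (fun r : ℝ => -Real.log (1 - r)) 1 0 := by
    have := (((hasDerivAt_id (0 : ℝ)).const_sub 1).log (by simp)).fun_neg
    simpa using this
  have h2 : HasDerivAt (fun u : ℝ => NormedSpace.exp (u • a)) a (-Real.log (1 - 0)) := by
    have := hasDerivAt_exp_smul_const (𝕂 := ℝ) a (-Real.log (1 - 0))
    simpa using this
  have := h2.scomp (0 : ℝ) h1
  rwa [one_smul] at this

theorem stronglyMeasurable_fractionFlow (a : 𝔸) :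
    MeasureTheory.StronglyMeasurable (fractionFlow a) := by
  let +nondep : NormedAlgebra ℚ 𝔸 := .restrictScalars ℚ ℝ 𝔸
  have hc : Continuous fun u : ℝ => NormedSpace.exp (u • a) :=
    NormedSpace.exp_continuous.comp (continuous_id.smul continuous_const)
  have hm : Measurable fun s : ℝ => -Real.log (1 - s) := by fun_prop
  exact hc.comp_stronglyMeasurable hm.stronglyMeasurable

theorem GeneratesContractions.intervalIntegrable_fractionFlow {a : 𝔸} (ha : GeneratesContractions a)
    {u v : ℝ}
    (hu : u ∈ Set.Icc (0 : ℝ) 1) (hv : v ∈ Set.Icc (0 : ℝ) 1) :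
    IntervalIntegrable (fractionFlow a) MeasureTheory.volume u v := by
  refine (intervalIntegrable_const (c := (1 : ℝ))).mono_fun
    (stronglyMeasurable_fractionFlow a).aestronglyMeasurable ?_
  refine (MeasureTheory.ae_restrict_mem measurableSet_uIoc).mono fun s hs => ?_
  simpa using ha.norm_fractionFlow_le_one
    (Set.uIcc_subset_Icc hu hv (Set.uIoc_subset_uIcc hs))

theorem GeneratesContractions.norm_integral_sub_integral_le {a : 𝔸}
    (ha : GeneratesContractions a) {u v : ℝ}
    (hu : u ∈ Set.Icc (0 : ℝ) 1) (hv : v ∈ Set.Icc (0 : ℝ) 1) :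
    ‖(∫ s in (0 : ℝ)..u, fractionFlow a s) - ∫ s in (0 : ℝ)..v, fractionFlow a s‖ ≤ |u - v| := by
  have h0 : (0 : ℝ) ∈ Set.Icc (0 : ℝ) 1 := ⟨le_rfl, zero_le_one⟩
  rw [intervalIntegral.integral_interval_sub_left (ha.intervalIntegrable_fractionFlow h0 hu)
    (ha.intervalIntegrable_fractionFlow h0 hv)]
  exact ha.norm_integral_fractionFlow_le hv hu

/-- If `Q r = 1 + r a + o(r)`, then `Q` agrees to first order with the flow of `a`. -/
theorem exists_norm_sub_fractionFlow_le {Q : ℝ → 𝔸} {a : 𝔸} (hQ0 : Q 0 = 1)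
    (hQ : (fun r : ℝ => Q r - (1 + r • a)) =o[𝓝[>] 0] fun r : ℝ => r) {η : ℝ} (hη : 0 < η) :
    ∃ ρ > 0, ∀ r, 0 ≤ r → r ≤ ρ →
      ‖Q r - fractionFlow a r‖ ≤ η * r ∧ ‖fractionFlow a r - 1‖ ≤ η := by
  have h2 : (fun r : ℝ => fractionFlow a r - (1 + r • a)) =o[𝓝[>] 0] fun r : ℝ => r := by
    have := (hasDerivAt_iff_isLittleO.1 (hasDerivAt_fractionFlow_zero a)).mono
      (nhdsWithin_le_nhds (s := Set.Ioi 0))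
    simpa [sub_sub, fractionFlow_zero] using this
  have h3 : ∀ᶠ r in 𝓝[>] (0 : ℝ), ‖Q r - fractionFlow a r‖ ≤ η * ‖r‖ := by
    have := (hQ.sub h2).bound hη
    simpa using this
  have h4 : ∀ᶠ r in 𝓝[>] (0 : ℝ), ‖fractionFlow a r - 1‖ ≤ η := by
    have hc := ((hasDerivAt_fractionFlow_zero a).continuousAt.sub_const 1).norm
    have : ∀ᶠ r in 𝓝 (0 : ℝ), ‖fractionFlow a r - 1‖ < η :=
      hc.eventually_lt_const (by simpa [fractionFlow_zero] using hη)
    exact (this.mono fun _ h => h.le).filter_mono nhdsWithin_le_nhds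
  obtain ⟨ρ, hρ, h⟩ := (mem_nhdsGT_iff_exists_Ioc_subset).1 (h3.and h4)
  refine ⟨ρ, hρ, fun r hr0 hr => ?_⟩
  rcases hr0.eq_or_lt with rfl | hr0
  -- The one-sided expansion does not see r = 0, the discount of stages of weight zero.
  · simp [hQ0, fractionFlow_zero, hη.le]
  · have := h ⟨hr0, hr⟩
    rwa [Set.mem_ofPred_eq, Real.norm_of_nonneg hr0.le] at this

end ContractionSemigroup

/-! ### Partial sums, discounts and the clock. -/

theorem Finset.sum_Icc_one_eq_range {M : Type*} [AddCommMonoid M] (f : ℕ → M) (h : f 0 = 0)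
    (n : ℕ) : ∑ m ∈ Finset.Icc 1 n, f m = ∑ m ∈ Finset.range (n + 1), f m := by
  induction n with
  | zero => simp [h]
  | succ n ih => rw [Finset.sum_Icc_succ_top (by omega), ih, Finset.sum_range_succ _ (n + 1)]

namespace Evaluation

/-- `∑_{m=1}^n θ_m`. -/
def cumWeight (θ : Evaluation) (n : ℕ) : ℝ := ∑ m ∈ Finset.Icc 1 n, θ.weight m

variable (θ : Evaluation)

@[simp] theorem cumWeight_zero : θ.cumWeight 0 = 0 := by simp [cumWeight]

theorem cumWeight_succ (n : ℕ) : θ.cumWeight (n + 1) = θ.cumWeight n + θ.weight (n + 1) :=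
  Finset.sum_Icc_succ_top (by omega) _

theorem cumWeight_eq_sum_range (n : ℕ) :
    θ.cumWeight n = ∑ m ∈ Finset.range (n + 1), θ.weight m :=
  Finset.sum_Icc_one_eq_range _ θ.weight_zero n

theorem cumWeight_nonneg (n : ℕ) : 0 ≤ θ.cumWeight n :=
  Finset.sum_nonneg fun _ _ => θ.weight_nonneg _

theorem cumWeight_le_one (n : ℕ) : θ.cumWeight n ≤ 1 :=
  sum_le_hasSum _ (fun _ _ => θ.weight_nonneg _) θ.hasSum_weight

theorem cumWeight_mem_Icc (n : ℕ) : θ.cumWeight n ∈ Set.Icc (0 : ℝ) 1 :=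
  ⟨θ.cumWeight_nonneg n, θ.cumWeight_le_one n⟩

theorem tendsto_cumWeight : Tendsto θ.cumWeight atTop (𝓝 1) := by
  rw [show θ.cumWeight = _ from funext θ.cumWeight_eq_sum_range]
  exact θ.hasSum_weight.tendsto_sum_nat.comp (tendsto_add_atTop_nat 1)

theorem weight_le_maxWeight (m : ℕ) : θ.weight m ≤ θ.maxWeight :=
  le_ciSup (f := θ.weight) ⟨1, by
    rintro _ ⟨m, rfl⟩
    exact le_hasSum θ.hasSum_weight m fun _ _ => θ.weight_nonneg _⟩ m

theorem discount_succ (m : ℕ) :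
    θ.discount (m + 1) = θ.weight (m + 1) / (1 - θ.cumWeight m) := by
  have h := θ.hasSum_weight.summable.sum_add_tsum_nat_add (m + 1)
  rw [θ.hasSum_weight.tsum_eq, ← cumWeight_eq_sum_range] at h
  rw [discount, ← h, add_sub_cancel_left]
  simp_rw [add_comm (m + 1)]

theorem discount_nonneg (m : ℕ) : 0 ≤ θ.discount m :=
  div_nonneg (θ.weight_nonneg m) (tsum_nonneg fun _ => θ.weight_nonneg _)

theorem clock_eq_top_or_coe {t : ℝ} (ht : 0 ≤ t) :
    (θ.clock t = ⊤ ∧ ∀ n, θ.cumWeight n ≤ t) ∨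
    ∃ M : ℕ, θ.clock t = M ∧ t ≤ θ.cumWeight M ∧ θ.cumWeight M ≤ t + θ.maxWeight := by
  classical
  by_cases h : ∃ M : ℕ, 1 ≤ M ∧ t ≤ θ.cumWeight M
  · right
    have hs := Nat.find_spec h
    refine ⟨Nat.find h, le_antisymm (iInf₂_le (Nat.find h) hs) (le_iInf₂ fun M hM => ?_), hs.2, ?_⟩
    · exact_mod_cast Nat.find_min' h hM
    · obtain ⟨n, hn⟩ : ∃ n, Nat.find h = n + 1 := ⟨Nat.find h - 1, by omega⟩
      have hmin := Nat.find_min h (m := n) (by omega)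
      rw [hn, cumWeight_succ]
      refine add_le_add ?_ (θ.weight_le_maxWeight _)
      -- Minimality only concerns indices at least 1; at index 0 the partial sum is 0 ≤ t.
      rcases Nat.eq_zero_or_pos n with rfl | hpos
      · simpa using ht
      · by_contra! hlt
        exact hmin ⟨hpos, hlt.le⟩
  · left
    push Not at h
    refine ⟨iInf₂_eq_top.2 fun M hM => absurd hM.2 (h M hM.1).not_ge, fun n => ?_⟩
    rcases Nat.eq_zero_or_pos n with rfl | hpos
    · simpa using ht
    · exact (h n hpos).le

end Evaluation

/-! ### Comparison of products and weighted sums with the flow. -/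

namespace Evaluation

section Product

variable {𝔸 : Type*} [NormedRing 𝔸] {Q : ℝ → 𝔸} (θ : Evaluation)

/-- `Q_{λ_1} ⋯ Q_{λ_n}`. -/
noncomputable def stageProd (θ : Evaluation) (Q : ℝ → 𝔸) (n : ℕ) : 𝔸 :=
  ((List.range n).map fun r => Q (θ.discount (r + 1))).prod

theorem stageProd_succ (n : ℕ) :
    θ.stageProd Q (n + 1) = θ.stageProd Q n * Q (θ.discount (n + 1)) := by
  simp [stageProd, List.range_succ]

theorem norm_stageProd_le_one [NormOneClass 𝔸] (hQ : ∀ r, ‖Q r‖ ≤ 1) (n : ℕ) :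
    ‖θ.stageProd Q n‖ ≤ 1 := by
  induction n with
  | zero => simp [stageProd]
  | succ n ih =>
    rw [stageProd_succ]
    exact (norm_mul_le _ _).trans (mul_le_one₀ ih (norm_nonneg _) (hQ _))

variable [NormedAlgebra ℝ 𝔸]

/-- `∑_{m=1}^n θ_m Q_{λ_1} ⋯ Q_{λ_m}`. -/
noncomputable def weightedSum (θ : Evaluation) (Q : ℝ → 𝔸) (n : ℕ) : 𝔸 :=
  ∑ m ∈ Finset.Icc 1 n, θ.weight m • θ.stageProd Q m

theorem weightedSum_succ (n : ℕ) : θ.weightedSum Q (n + 1) =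
    θ.weightedSum Q n + θ.weight (n + 1) • θ.stageProd Q (n + 1) :=
  Finset.sum_Icc_succ_top (by omega) _

/-- The term `θ_m Q_{λ_1} ⋯ Q_{λ_m}` if `1 ≤ m ≤ φ(θ, t)`, and `0` for the other `m`. -/
noncomputable def clockTerm (θ : Evaluation) (Q : ℝ → 𝔸) (t : ℝ) : ℕ → 𝔸 :=
  Set.indicator {m : ℕ | 1 ≤ m ∧ (m : ℕ∞) ≤ θ.clock t} fun m => θ.weight m • θ.stageProd Q m

theorem tsum_clockTerm_of_coe {t : ℝ} {M : ℕ} (h : θ.clock t = M) :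
    ∑' m, θ.clockTerm Q t m = θ.weightedSum Q M := by
  have hset : {m : ℕ | 1 ≤ m ∧ (m : ℕ∞) ≤ θ.clock t} = (Finset.Icc 1 M : Finset ℕ) := by
    ext m; simp [h]
  rw [clockTerm, hset, ← sum_eq_tsum_indicator, weightedSum]

theorem norm_smul_stageProd_sub_integral_le_two_mul [NormOneClass 𝔸] {a : 𝔸}
    (ha : GeneratesContractions a) (hQ : ∀ r, ‖Q r‖ ≤ 1) (n : ℕ) :
    ‖θ.weight (n + 1) • θ.stageProd Q (n + 1) -
      ∫ s in θ.cumWeight n..θ.cumWeight (n + 1), fractionFlow a s‖ ≤ 2 * θ.weight (n + 1) := by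
  have h1 := ha.norm_integral_fractionFlow_le (θ.cumWeight_mem_Icc n) (θ.cumWeight_mem_Icc (n + 1))
  rw [cumWeight_succ, add_sub_cancel_left, abs_of_nonneg (θ.weight_nonneg _),
    ← cumWeight_succ] at h1
  have h2 : ‖θ.weight (n + 1) • θ.stageProd Q (n + 1)‖ ≤ θ.weight (n + 1) := by
    rw [norm_smul, Real.norm_of_nonneg (θ.weight_nonneg _)]
    exact mul_le_of_le_one_right (θ.weight_nonneg _) (θ.norm_stageProd_le_one hQ _)
  linarith [norm_sub_le (θ.weight (n + 1) • θ.stageProd Q (n + 1))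
    (∫ s in θ.cumWeight n..θ.cumWeight (n + 1), fractionFlow a s)]

variable [CompleteSpace 𝔸] {a : 𝔸} {η ρ δ : ℝ}

theorem norm_stageProd_sub_fractionFlow_le (ha : GeneratesContractions a)
    (hQ : ∀ r, ‖Q r‖ ≤ 1) (hη : 0 < η) (hδ : 0 < δ)
    (H : ∀ r, 0 ≤ r → r ≤ ρ → ‖Q r - fractionFlow a r‖ ≤ η * r ∧ ‖fractionFlow a r - 1‖ ≤ η)
    (hθ : θ.maxWeight ≤ ρ * δ) {n : ℕ} (hn : θ.cumWeight n ≤ 1 - δ) :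
    ‖θ.stageProd Q n - fractionFlow a (θ.cumWeight n)‖ ≤ η / δ * θ.cumWeight n := by
  induction n with
  | zero => simp [stageProd, fractionFlow_zero]
  | succ n ih =>
    have hw := θ.weight_nonneg (n + 1)
    have hs : θ.cumWeight (n + 1) = _ := θ.cumWeight_succ n
    have hpos : δ ≤ 1 - θ.cumWeight n := by linarith
    have hlam : θ.discount (n + 1) ≤ θ.weight (n + 1) / δ := by
      rw [discount_succ]; gcongr
    have hlam' : θ.discount (n + 1) ≤ ρ := hlam.trans
      ((div_le_iff₀ hδ).2 ((θ.weight_le_maxWeight _).trans hθ))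
    have hmul : fractionFlow a (θ.cumWeight n) * fractionFlow a (θ.discount (n + 1)) =
        fractionFlow a (θ.cumWeight (n + 1)) := by
      refine fractionFlow_mul a (by linarith) (by linarith) ?_
      rw [discount_succ, div_mul_cancel₀ _ (by linarith), hs, add_sub_cancel_left]
    -- The old error is multiplied by a contraction; the new one is a contraction times the
    -- one-stage error.
    have hsplit : θ.stageProd Q (n + 1) - fractionFlow a (θ.cumWeight (n + 1)) =
        (θ.stageProd Q n - fractionFlow a (θ.cumWeight n)) * Q (θ.discount (n + 1)) +
        fractionFlow a (θ.cumWeight n) *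
          (Q (θ.discount (n + 1)) - fractionFlow a (θ.discount (n + 1))) := by
      rw [stageProd_succ, ← hmul]; noncomm_ring
    rw [hsplit, hs, mul_add]
    refine (norm_add_le _ _).trans (add_le_add ?_ ?_)
    · exact ((norm_mul_le _ _).trans (mul_le_of_le_one_right (norm_nonneg _) (hQ _))).trans
        (ih (by linarith))
    · refine ((norm_mul_le _ _).trans (mul_le_of_le_one_left (norm_nonneg _)
        (ha.norm_fractionFlow_le_one (θ.cumWeight_mem_Icc n)))).trans ?_
      refine (H _ (θ.discount_nonneg _) hlam').1.trans ?_
      rw [div_mul_eq_mul_div, mul_div_assoc]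
      gcongr

theorem norm_smul_stageProd_sub_integral_le (ha : GeneratesContractions a)
    (hQ : ∀ r, ‖Q r‖ ≤ 1) (hη : 0 < η) (hδ : 0 < δ)
    (H : ∀ r, 0 ≤ r → r ≤ ρ → ‖Q r - fractionFlow a r‖ ≤ η * r ∧ ‖fractionFlow a r - 1‖ ≤ η)
    (hθ : θ.maxWeight ≤ ρ * δ) {n : ℕ} (hn : θ.cumWeight (n + 1) ≤ 1 - δ) :
    ‖θ.weight (n + 1) • θ.stageProd Q (n + 1) -
      ∫ s in θ.cumWeight n..θ.cumWeight (n + 1), fractionFlow a s‖ ≤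
      (η / δ + η) * θ.weight (n + 1) := by
  have hw := θ.weight_nonneg (n + 1)
  have hs := θ.cumWeight_succ n
  have hint := ha.intervalIntegrable_fractionFlow (θ.cumWeight_mem_Icc n)
    (θ.cumWeight_mem_Icc (n + 1))
  have hconst : θ.weight (n + 1) • θ.stageProd Q (n + 1) =
      ∫ _ in θ.cumWeight n..θ.cumWeight (n + 1), θ.stageProd Q (n + 1) := by
    rw [intervalIntegral.integral_const, hs, add_sub_cancel_left]
  rw [hconst, ← intervalIntegral.integral_sub intervalIntegrable_const hint]
  have hlen : |θ.cumWeight (n + 1) - θ.cumWeight n| = θ.weight (n + 1) := by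
    rw [hs, add_sub_cancel_left, abs_of_nonneg hw]
  rw [← hlen]
  refine intervalIntegral.norm_integral_le_of_norm_le_const fun s hs' => ?_
  rw [Set.uIoc_of_le (by linarith)] at hs'
  have hs0 : 0 ≤ s := (θ.cumWeight_nonneg n).trans hs'.1.le
  have hs1 : δ ≤ 1 - s := by linarith [hs'.2]
  -- This is the discount that carries the flow from s to the end of the stage.
  have hr : (θ.cumWeight (n + 1) - s) / (1 - s) ≤ ρ := by
    rw [div_le_iff₀ (by linarith)]
    have := θ.weight_le_maxWeight (n + 1)
    have hρ : 0 ≤ ρ := nonneg_of_mul_nonneg_left (hw.trans (this.trans hθ)) hδ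
    nlinarith [hs'.1]
  have hflow : fractionFlow a (θ.cumWeight (n + 1)) - fractionFlow a s = fractionFlow a s *
      (fractionFlow a ((θ.cumWeight (n + 1) - s) / (1 - s)) - 1) := by
    rw [mul_sub, mul_one, fractionFlow_mul a (by linarith) (by linarith)
      (div_mul_cancel₀ _ (by linarith))]
  calc ‖θ.stageProd Q (n + 1) - fractionFlow a s‖
      ≤ ‖θ.stageProd Q (n + 1) - fractionFlow a (θ.cumWeight (n + 1))‖ +
        ‖fractionFlow a (θ.cumWeight (n + 1)) - fractionFlow a s‖ :=
      norm_sub_le_norm_sub_add_norm_sub _ _ _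
    _ ≤ η / δ + η := by
      refine add_le_add ((θ.norm_stageProd_sub_fractionFlow_le ha hQ hη hδ H hθ hn).trans
        (mul_le_of_le_one_right (by positivity) (θ.cumWeight_le_one _))) ?_
      rw [hflow]
      refine ((norm_mul_le _ _).trans (mul_le_of_le_one_left (norm_nonneg _)
        (ha.norm_fractionFlow_le_one ⟨hs0, by linarith⟩))).trans ?_
      exact (H _ (div_nonneg (by linarith [hs'.2]) (by linarith)) hr).2

variable [NormOneClass 𝔸]

/-- The `max` term pays for the stages ending after 1-δ, where only the trivial bound is available.
-/
theorem norm_weightedSum_sub_integral_le_max (ha : GeneratesContractions a)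
    (hQ : ∀ r, ‖Q r‖ ≤ 1) (hη : 0 < η) (hδ : 0 < δ)
    (H : ∀ r, 0 ≤ r → r ≤ ρ → ‖Q r - fractionFlow a r‖ ≤ η * r ∧ ‖fractionFlow a r - 1‖ ≤ η)
    (hθ : θ.maxWeight ≤ ρ * δ) (n : ℕ) :
    ‖θ.weightedSum Q n - ∫ s in (0 : ℝ)..θ.cumWeight n, fractionFlow a s‖ ≤
      (η / δ + η) * θ.cumWeight n + 2 * max 0 (θ.cumWeight n - (1 - δ - θ.maxWeight)) := by
  induction n with
  | zero => simp [weightedSum]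
  | succ n ih =>
    have hw := θ.weight_nonneg (n + 1)
    have hs := θ.cumWeight_succ n
    have hmax := θ.weight_le_maxWeight (n + 1)
    have h0 : (0 : ℝ) ∈ Set.Icc (0 : ℝ) 1 := ⟨le_rfl, zero_le_one⟩
    have hsplit : θ.weightedSum Q (n + 1) -
        ∫ s in (0 : ℝ)..θ.cumWeight (n + 1), fractionFlow a s =
        (θ.weightedSum Q n - ∫ s in (0 : ℝ)..θ.cumWeight n, fractionFlow a s) +
        (θ.weight (n + 1) • θ.stageProd Q (n + 1) -
          ∫ s in θ.cumWeight n..θ.cumWeight (n + 1), fractionFlow a s) := by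
      rw [weightedSum_succ, ← intervalIntegral.integral_add_adjacent_intervals
        (ha.intervalIntegrable_fractionFlow h0 (θ.cumWeight_mem_Icc n))
        (ha.intervalIntegrable_fractionFlow (θ.cumWeight_mem_Icc n) (θ.cumWeight_mem_Icc (n + 1)))]
      abel
    rw [hsplit]
    refine (norm_add_le _ _).trans ((add_le_add_left ih _).trans ?_)
    rcases le_or_gt (θ.cumWeight (n + 1)) (1 - δ) with hn | hn
    · have h1 := θ.norm_smul_stageProd_sub_integral_le ha hQ hη hδ H hθ hn
      have h2 : max 0 (θ.cumWeight n - (1 - δ - θ.maxWeight)) ≤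
          max 0 (θ.cumWeight (n + 1) - (1 - δ - θ.maxWeight)) :=
        max_le_max_left _ (by linarith)
      rw [hs] at h2 h1 ⊢
      linarith
    · have h1 := θ.norm_smul_stageProd_sub_integral_le_two_mul ha hQ n
      have h2 : 0 ≤ (η / δ + η) * θ.weight (n + 1) := by positivity
      -- Even a stage straddling 1-δ starts after 1-δ-‖θ‖, so both maxima are on their linear branch
      -- and differ by the weight of the stage.
      rw [max_eq_right (by linarith), max_eq_right (by linarith)]
      rw [hs] at h1 ⊢
      linarith

theorem exists_norm_weightedSum_sub_integral_le (ha : GeneratesContractions a)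
    (hQ : ∀ r, ‖Q r‖ ≤ 1) (hQ0 : Q 0 = 1)
    (hQa : (fun r : ℝ => Q r - (1 + r • a)) =o[𝓝[>] 0] fun r : ℝ => r) {ε : ℝ} (hε : 0 < ε) :
    ∃ κ > 0, ∀ θ : Evaluation, θ.maxWeight ≤ κ → ∀ n,
      ‖θ.weightedSum Q n - ∫ s in (0 : ℝ)..θ.cumWeight n, fractionFlow a s‖ ≤ ε := by
  -- The end of the game costs 2(δ+‖θ‖) ≤ ε/2 and the rest η/δ+η = ε/2; ‖θ‖ ≤ ρδ keeps the relevant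
  -- discounts below ρ.
  obtain ⟨δ, hδ, hδε⟩ : ∃ δ : ℝ, 0 < δ ∧ δ = ε / 8 := ⟨_, by positivity, rfl⟩
  obtain ⟨η, hη, hηε⟩ : ∃ η : ℝ, 0 < η ∧ η / δ + η = ε / 2 :=
    ⟨ε / 2 / (1 / δ + 1), by positivity, by field_simp⟩
  obtain ⟨ρ, hρ, H⟩ := exists_norm_sub_fractionFlow_le hQ0 hQa hη
  refine ⟨min (ρ * δ) (ε / 8), by positivity, fun θ hθ n => ?_⟩
  refine (θ.norm_weightedSum_sub_integral_le_max ha hQ hη hδ H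
    (hθ.trans (min_le_left _ _)) n).trans ?_
  have h1 : max 0 (θ.cumWeight n - (1 - δ - θ.maxWeight)) ≤ ε / 4 :=
    max_le (by positivity) (by linarith [θ.cumWeight_le_one n, hθ.trans (min_le_right _ _)])
  have h2 := mul_le_of_le_one_right (show 0 ≤ ε / 2 by positivity) (θ.cumWeight_le_one n)
  rw [hηε]
  linarith

theorem summable_clockTerm (hQ : ∀ r, ‖Q r‖ ≤ 1) (t : ℝ) : Summable (θ.clockTerm Q t) := by
  refine Summable.of_norm_bounded θ.hasSum_weight.summable fun m => ?_
  refine (norm_indicator_le_norm_self _ _).trans ?_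
  rw [norm_smul, Real.norm_of_nonneg (θ.weight_nonneg _)]
  exact mul_le_of_le_one_right (θ.weight_nonneg _) (θ.norm_stageProd_le_one hQ _)

theorem tendsto_weightedSum_of_top (hQ : ∀ r, ‖Q r‖ ≤ 1) {t : ℝ} (h : θ.clock t = ⊤) :
    Tendsto (θ.weightedSum Q) atTop (𝓝 (∑' m, θ.clockTerm Q t m)) := by
  refine ((θ.summable_clockTerm hQ t).hasSum.tendsto_sum_nat.comp
    (tendsto_add_atTop_nat 1)).congr fun n => ?_
  rw [Function.comp_apply, ← Finset.sum_Icc_one_eq_range _ (by simp [clockTerm]), weightedSum]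
  refine Finset.sum_congr rfl fun m hm => ?_
  have hmem : m ∈ {m : ℕ | 1 ≤ m ∧ (m : ℕ∞) ≤ θ.clock t} :=
    ⟨(Finset.mem_Icc.1 hm).1, h ▸ le_top⟩
  exact Set.indicator_of_mem hmem _

theorem norm_tsum_clockTerm_sub_integral_le (ha : GeneratesContractions a)
    (hQ : ∀ r, ‖Q r‖ ≤ 1) {t ε : ℝ} (ht : t ∈ Set.Icc (0 : ℝ) 1)
    (hε : ∀ n, ‖θ.weightedSum Q n - ∫ s in (0 : ℝ)..θ.cumWeight n, fractionFlow a s‖ ≤ ε) :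
    ‖∑' m, θ.clockTerm Q t m - ∫ s in (0 : ℝ)..t, fractionFlow a s‖ ≤ ε + θ.maxWeight := by
  have hle : ∀ n, ‖θ.weightedSum Q n - ∫ s in (0 : ℝ)..t, fractionFlow a s‖ ≤
      ε + |θ.cumWeight n - t| := fun n =>
    (norm_sub_le_norm_sub_add_norm_sub _ _ _).trans (add_le_add (hε n)
      (ha.norm_integral_sub_integral_le (θ.cumWeight_mem_Icc n) ht))
  rcases θ.clock_eq_top_or_coe ht.1 with ⟨h, hn⟩ | ⟨M, h, h1, h2⟩
  -- The partial sums tend to 1 and never exceed t, so an infinite clock forces t = 1.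
  · have ht1 : t = 1 := le_antisymm ht.2 (le_of_tendsto' θ.tendsto_cumWeight hn)
    have hlim : Tendsto (fun n => ε + |θ.cumWeight n - t|) atTop (𝓝 (ε + |1 - t|)) :=
      (θ.tendsto_cumWeight.sub_const t).abs.const_add ε
    have := le_of_tendsto_of_tendsto' ((θ.tendsto_weightedSum_of_top hQ h).sub_const _).norm
      hlim hle
    refine this.trans ?_
    rw [ht1, sub_self, abs_zero]
    gcongr
    exact (θ.weight_nonneg 0).trans (θ.weight_le_maxWeight 0)
  · rw [θ.tsum_clockTerm_of_coe h]
    refine (hle M).trans ?_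
    rw [abs_of_nonneg (sub_nonneg.2 h1)]
    linarith

theorem tendsto_tsum_clockTerm (ha : GeneratesContractions a)
    (hQ : ∀ r, ‖Q r‖ ≤ 1) (hQ0 : Q 0 = 1)
    (hQa : (fun r : ℝ => Q r - (1 + r • a)) =o[𝓝[>] 0] fun r : ℝ => r)
    {t : ℝ} (ht : t ∈ Set.Icc (0 : ℝ) 1) :
    Tendsto (fun θ : Evaluation => ∑' m, θ.clockTerm Q t m) vanishing
      (𝓝 (∫ s in (0 : ℝ)..t, fractionFlow a s)) := by
  refine Metric.tendsto_nhds.2 fun ε hε => ?_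
  obtain ⟨κ, hκ, h⟩ := exists_norm_weightedSum_sub_integral_le ha hQ hQ0 hQa (half_pos hε)
  have hsmall : ∀ᶠ θ in vanishing, θ.maxWeight < min κ (ε / 2) :=
    tendsto_comap.eventually_lt_const (by positivity)
  filter_upwards [hsmall] with θ hθ
  rw [dist_eq_norm]
  refine (θ.norm_tsum_clockTerm_sub_integral_le ha hQ ht
    (h θ (hθ.le.trans (min_le_left _ _)))).trans_lt ?_
  linarith [hθ.trans_le (min_le_right _ _)]

end Product

end Evaluation

/-! ### Stochastic and rate matrices in the maximal row-sum norm. -/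

section MatrixNorm

attribute [local instance] Matrix.linftyOpNormedRing Matrix.linftyOpNormedAlgebra

variable {K : Type*} [Fintype K] [DecidableEq K]

theorem Matrix.linftyOp_norm_le_of_nonneg {B : Matrix K K ℝ} {c : ℝ} (hc : 0 ≤ c)
    (h0 : ∀ k l, 0 ≤ B k l) (h1 : ∀ k, ∑ l, B k l ≤ c) : ‖B‖ ≤ c := by
  rw [Matrix.linfty_opNorm_def]
  lift c to NNReal using hc
  rw [NNReal.coe_le_coe]
  refine Finset.sup_le fun k _ => ?_
  rw [← NNReal.coe_le_coe, NNReal.coe_sum]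
  refine le_trans (Finset.sum_le_sum fun l _ => ?_) (h1 k)
  rw [coe_nnnorm, Real.norm_of_nonneg (h0 k l)]

theorem Matrix.linftyOp_norm_le_sum (B : Matrix K K ℝ) : ‖B‖ ≤ ∑ k, ∑ l, ‖B k l‖ := by
  have h : (Finset.univ.sup fun k => ∑ l, ‖B k l‖₊) ≤ ∑ k, ∑ l, ‖B k l‖₊ :=
    Finset.sup_le fun k hk =>
      Finset.single_le_sum (f := fun k => ∑ l, ‖B k l‖₊) (fun _ _ => zero_le) hk
  rw [Matrix.linfty_opNorm_def]
  refine (NNReal.coe_le_coe.2 h).trans_eq ?_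
  simp only [NNReal.coe_sum, coe_nnnorm]

theorem Matrix.linftyOp_normOneClass [Nonempty K] : NormOneClass (Matrix K K ℝ) :=
  ⟨le_antisymm (Matrix.linftyOp_norm_le_of_nonneg zero_le_one
    (fun k l => by rw [Matrix.one_apply]; split_ifs <;> norm_num) fun k => by
      simp [Matrix.one_apply]) (one_le_norm_one _)⟩

/-- Uniformization: for large c, A + c·Id is nonnegative with row sums c, so its norm is at most c
and e^{τA} = e^{-τc}e^{τ(A+c·Id)} is a contraction. -/
theorem IsRateMatrix.generatesContractions [Nonempty K] {A : Matrix K K ℝ}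
    (hA : IsRateMatrix A) : GeneratesContractions A := by
  have := Matrix.linftyOp_normOneClass (K := K)
  obtain ⟨c, hc⟩ : ∃ c : ℝ, ∀ k, -A k k ≤ c :=
    ⟨∑ k, |A k k|, fun k => (neg_le_abs _).trans
      (Finset.single_le_sum (f := fun k => |A k k|) (fun _ _ => abs_nonneg _)
        (Finset.mem_univ k))⟩
  have hc' : ∀ k l, 0 ≤ (A + algebraMap ℝ (Matrix K K ℝ) c) k l := fun k l => by
    rw [Matrix.add_apply, Matrix.algebraMap_matrix_apply]
    by_cases h : k = l
    · subst h
      simpa [add_comm] using neg_le_iff_add_nonneg.1 (hc k)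
    · simpa [h] using hA.1 k l h
  have hsum : ∀ k, ∑ l, (A + algebraMap ℝ (Matrix K K ℝ) c) k l = c := fun k => by
    simp [Finset.sum_add_distrib, hA.2 k, Matrix.algebraMap_matrix_apply]
  have hc0 : 0 ≤ c := by
    obtain ⟨k⟩ := ‹Nonempty K›
    exact (Finset.sum_nonneg fun l _ => hc' k l).trans_eq (hsum k)
  have := generatesContractions_sub_algebraMap
    (Matrix.linftyOp_norm_le_of_nonneg hc0 hc' fun k => (hsum k).le)
  rwa [add_sub_cancel_right] at this

theorem StochasticGame.norm_transitionMatrix_le_one {I J : Type*} [Fintype I] [Fintype J]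
    (G : StochasticGame K I J) (x : StationaryStrategy K I) (y : StationaryStrategy K J) :
    ‖G.transitionMatrix x y‖ ≤ 1 := by
  refine Matrix.linftyOp_norm_le_of_nonneg zero_le_one (fun k l => ?_) fun k => le_of_eq ?_
  · exact Finset.sum_nonneg fun i _ => Finset.sum_nonneg fun j _ =>
      mul_nonneg (mul_nonneg ((x k).2.1 i) ((y k).2.1 j)) ((G.q k i j).2.1 l)
  · simp only [StochasticGame.transitionMatrix, Matrix.of_apply]
    rw [Finset.sum_comm]
    simp_rw [Finset.sum_comm (s := Finset.univ (α := K)), ← Finset.mul_sum, (G.q k _ _).2.2,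
      mul_one, ← Finset.mul_sum, (y k).2.2, mul_one, (x k).2.2]

theorem IsCriticalWith.isLittleO {Q : ℝ → Matrix K K ℝ} {A : Matrix K K ℝ}
    (hQ : IsCriticalWith Q A) :
    (fun r : ℝ => Q r - (1 + r • A)) =o[𝓝[>] 0] fun r : ℝ => r := by
  have hs : (fun r : ℝ => ∑ k, ∑ l, ‖(Q r - (1 + r • A)) k l‖) =o[𝓝[>] 0] fun r : ℝ => r :=
    Asymptotics.IsLittleO.fun_sum fun k _ =>
      Asymptotics.IsLittleO.fun_sum fun l _ => (hQ.2.2 k l).norm_left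
  refine (Asymptotics.IsBigO.of_bound 1 (Eventually.of_forall fun r => ?_)).trans_isLittleO hs
  rw [one_mul]
  exact (Matrix.linftyOp_norm_le_sum _).trans (Real.le_norm_self _)

/-- Taking an entry is a continuous linear functional, so it commutes with the Bochner integral. -/
theorem IsRateMatrix.intervalIntegrable_and_integral_apply [Nonempty K] {A : Matrix K K ℝ}
    (hA : IsRateMatrix A) {t : ℝ} (ht : t ∈ Set.Icc (0 : ℝ) 1) (k l : K) :
    IntervalIntegrable (fun s => fractionFlow A s k l) MeasureTheory.volume 0 t ∧
    ∫ s in (0 : ℝ)..t, fractionFlow A s k l = (∫ s in (0 : ℝ)..t, fractionFlow A s) k l := by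
  let L : Matrix K K ℝ →L[ℝ] ℝ :=
    LinearMap.mkContinuous (Matrix.entryLinearMap ℝ ℝ k l) 1 fun B => by
      rw [one_mul, Matrix.linfty_opNorm_def]
      have h : ‖B k l‖₊ ≤ Finset.univ.sup fun k => ∑ l, ‖B k l‖₊ :=
        (Finset.single_le_sum (f := fun l => ‖B k l‖₊) (fun _ _ => zero_le)
          (Finset.mem_univ l)).trans
          (Finset.le_sup (f := fun k => ∑ l, ‖B k l‖₊) (Finset.mem_univ k))
      exact_mod_cast h
  have hi := hA.generatesContractions.intervalIntegrable_fractionFlow ⟨le_rfl, zero_le_one⟩ ht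
  exact ⟨⟨L.integrable_comp hi.1, L.integrable_comp hi.2⟩, L.intervalIntegral_comp_comm hi⟩

theorem StochasticGame.summable_and_tendsto_cumulatedTerm [Nonempty K] {I J : Type*} [Fintype I]
    [Fintype J] (G : StochasticGame K I J)
    (x : ℝ → StationaryStrategy K I) (y : ℝ → StationaryStrategy K J) {A : Matrix K K ℝ}
    (hQ : IsCriticalWith (fun r => G.transitionMatrix (x r) (y r)) A)
    {t : ℝ} (ht : t ∈ Set.Icc (0 : ℝ) 1) :
    (∀ θ : Evaluation, Summable (G.cumulatedTerm x y θ t)) ∧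
    (∀ k l, IntervalIntegrable (fun s : ℝ => NormedSpace.exp ((-Real.log (1 - s)) • A) k l)
      MeasureTheory.volume 0 t) ∧
    Tendsto (fun θ : Evaluation => ∑' m, G.cumulatedTerm x y θ t m) Evaluation.vanishing
      (𝓝 (Matrix.of fun k l => ∫ s in (0 : ℝ)..t,
        NormedSpace.exp ((-Real.log (1 - s)) • A) k l)) := by
  have := Matrix.linftyOp_normOneClass (K := K)
  have hbound := fun r => G.norm_transitionMatrix_le_one (x r) (y r)
  have hflow := fun k l => hQ.1.intervalIntegrable_and_integral_apply ht k l
  refine ⟨fun θ => θ.summable_clockTerm hbound t, fun k l => (hflow k l).1, ?_⟩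
  have hint : (Matrix.of fun k l => ∫ s in (0 : ℝ)..t,
      NormedSpace.exp ((-Real.log (1 - s)) • A) k l) = ∫ s in (0 : ℝ)..t, fractionFlow A s :=
    Matrix.ext fun k l => (hflow k l).2
  rw [hint]
  exact Evaluation.tendsto_tsum_clockTerm hQ.1.generatesContractions hbound hQ.2.1
    hQ.isLittleO ht

end MatrixNorm

theorem mainTheorem8 {K I J : Type*} [Fintype K] [DecidableEq K] [Fintype I] [Fintype J]
    (G : StochasticGame K I J)
    (x : ℝ → StationaryStrategy K I) (y : ℝ → StationaryStrategy K J)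
    (A : Matrix K K ℝ)
    (hQ : IsCriticalWith (fun r => G.transitionMatrix (x r) (y r)) A)
    (t : ℝ) (ht : t ∈ Set.Icc (0 : ℝ) 1) :
    (∀ θ : Evaluation, Summable (G.cumulatedTerm x y θ t)) ∧
    (∀ k l, IntervalIntegrable (fun s : ℝ => NormedSpace.exp ((-Real.log (1 - s)) • A) k l)
      MeasureTheory.volume 0 t) ∧
    Tendsto (fun θ : Evaluation => ∑' m, G.cumulatedTerm x y θ t m) Evaluation.vanishing
      (𝓝 (Matrix.of fun k l => ∫ s in (0 : ℝ)..t,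
        NormedSpace.exp ((-Real.log (1 - s)) • A) k l)) := by
  -- Without states the identity matrix has norm 0, so `NormOneClass` fails; all matrices then
  -- coincide.
  rcases isEmpty_or_nonempty K with hK | hK
  · refine ⟨fun θ => ?_, fun k => isEmptyElim k, ?_⟩
    · rw [Subsingleton.elim (G.cumulatedTerm x y θ t) 0]
      exact summable_zero
    · exact tendsto_const_nhds.congr fun θ => Subsingleton.elim _ _
  · exact G.summable_and_tendsto_cumulatedTerm x y hQ ht
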